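/- Let $M$ be a closed connected orientable surface of genus $g$ with $n$ marked points $p_1,\dots,p_n$, where $2-2g-n<0$, and let $S=\{p_1,\dots,p_n\}$. A dilation structure $\Sigma$ on $(M,S)$ is an atlas on $M\setminus S$ with values in $\mathbb{C}$ whose transition maps are locally of the form $z\mapsto az+b$ with $a>0$ real and $b\in\mathbb{C}$, such that every $s\in S$ is a conical-dilation singularity: for some integer $k\ge 1$ and some $\lambda>0$, a punctured neighbourhood of $s$ is isomorphic to a punctured neighbourhood of the apex in the quotient of the universal cover $\widetilde{\mathbb{C}^*}$ (with coordinate $w=\log z$ and developing map $\exp$) by $w\mapsto w+\log\lambda+2i\pi k$. Let $\mathcal{MD}_{g,n}$ be the set of such structures, up to isomorphism, that admit a geodesic triangulation, i.e. a triangulation (in the sense of gluings of finitely many Euclidean triangles, in which edges or vertices of the same triangle may be identified) whose edges are geodesic segments and whose set of vertices is exactly $S$. A dilation cylinder of angle $\theta>0$ and multiplier $\rho>1$ is the quotient of an open angular sector of angle $\theta$ with apex $0$ by $z\mapsto\rho z$. Let $\Theta(\Sigma)$ be the supremum of the angles of the dilation cylinders embedded in $M\setminus S$ by a map preserving the dilation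 structures ($\Theta(\Sigma)=0$ if there are none). For $t\in\mathbb{R}$, let $g_t\cdot\Sigma$ be the structure obtained by composing every chart of $\Sigma$ with the linear map $\begin{pmatrix}e^t&0\\0&e^{-t}\end{pmatrix}$ of $\mathbb{C}=\mathbb{R}^2$ (Teichmüller flow). For $\theta\in S^1=\mathbb{R}/2\pi\mathbb{Z}$, the foliation of $\Sigma$ in direction $\theta$ is the foliation of $M\setminus S$ by the oriented straight lines of direction $e^{i\theta}$. A closed leaf in $M\setminus S$ is hyperbolic if the first return map of the foliation to a small segment transverse to the leaf is contracting or dilating near the leaf. Let $\mathcal{C}_\Sigma\subset S^1$ be the set of directions $\theta$ such that the foliation in direction $\theta$ has no hyperbolic closed leaf. A point $x\in S^1$ is a density point of $A\subset S^1$ if $\mathrm{Leb}(A\cap B(x,r))/\mathrm{Leb}(B(x,r))\to 1$ as $r\to 0^+$. **Statement.** Let $\Sigma\in\mathcal{MD}_{g,n}$. If $\Theta(g_t\cdot\Sigma)$ does not tend to $0$ as $t\to+\infty$, then the vertical direction $\frac{\pi}{2}$ is not a density point of $\mathcal{C}_\Sigma$. -/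

import Mathlib

open Set Filter Topology MeasureTheory

noncomputable section

namespace Dilation

/-- A dilation atlas on `M \ S`: charts with values in `ℂ` whose domains cover `M \ S` and whose
transition maps are locally of the form `z ↦ a z + b` with `a > 0` real and `b ∈ ℂ`. -/
structure DilationAtlas (M : Type*) [TopologicalSpace M] (S : Set M) where
  atlas : Set (OpenPartialHomeomorph M ℂ)
  source_subset : ∀ e ∈ atlas, e.source ⊆ Sᶜ
  covers : ∀ x ∉ S, ∃ e ∈ atlas, x ∈ e.source
  compatible : ∀ e ∈ atlas, ∀ e' ∈ atlas, ∀ x ∈ e.source ∩ e'.source,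
    ∃ (a : ℝ) (b : ℂ), 0 < a ∧ ∀ᶠ y in 𝓝 x, e' y = a * e y + b

/-- The linear action of `SL₂(ℝ)` on the plane `ℂ = ℝ²`. -/
def planeHomeo (A : Matrix.SpecialLinearGroup (Fin 2) ℝ) : ℂ ≃ₜ ℂ where
  toFun z := ⟨A 0 0 * z.re + A 0 1 * z.im, A 1 0 * z.re + A 1 1 * z.im⟩
  invFun z := ⟨A 1 1 * z.re - A 0 1 * z.im, -A 1 0 * z.re + A 0 0 * z.im⟩
  left_inv z := by
    have h := A.det_coe
    rw [Matrix.det_fin_two] at h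
    apply Complex.ext <;> simp only
    · linear_combination z.re * h
    · linear_combination z.im * h
  right_inv z := by
    have h := A.det_coe
    rw [Matrix.det_fin_two] at h
    apply Complex.ext <;> simp only
    · linear_combination z.re * h
    · linear_combination z.im * h
  continuous_toFun := by
    have : (fun z : ℂ => (⟨A 0 0 * z.re + A 0 1 * z.im, A 1 0 * z.re + A 1 1 * z.im⟩ : ℂ)) =
        fun z : ℂ => ((A 0 0 * z.re + A 0 1 * z.im : ℝ) : ℂ) +
          ((A 1 0 * z.re + A 1 1 * z.im : ℝ) : ℂ) * Complex.I := by
      funext z; apply Complex.ext <;> simp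
    rw [this]; fun_prop
  continuous_invFun := by
    have : (fun z : ℂ => (⟨A 1 1 * z.re - A 0 1 * z.im, -A 1 0 * z.re + A 0 0 * z.im⟩ : ℂ)) =
        fun z : ℂ => ((A 1 1 * z.re - A 0 1 * z.im : ℝ) : ℂ) +
          ((-A 1 0 * z.re + A 0 0 * z.im : ℝ) : ℂ) * Complex.I := by
      funext z; apply Complex.ext <;> simp
    rw [this]; fun_prop

theorem planeHomeo_affine (A : Matrix.SpecialLinearGroup (Fin 2) ℝ) (a : ℝ) (z b : ℂ) :
    planeHomeo A (a * z + b) = a * planeHomeo A z + planeHomeo A b := by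
  apply Complex.ext <;> simp [planeHomeo] <;> ring

/-- The diagonal matrix with entries `e ^ t` and `e ^ (-t)`. -/
def teichmullerMatrix (t : ℝ) : Matrix.SpecialLinearGroup (Fin 2) ℝ :=
  ⟨!![Real.exp t, 0; 0, Real.exp (-t)], by
    rw [Matrix.det_fin_two_of, ← Real.exp_add]; simp⟩

/-- Directions, that is points of `S¹ = ℝ / 2πℤ`. -/
abbrev Direction : Type := AddCircle (2 * Real.pi)

instance factTwoPiPos : Fact (0 < 2 * Real.pi) := ⟨Real.two_pi_pos⟩

/-- The unit vector `e ^ (i θ)`. -/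
def unitVector (θ : Direction) : ℂ := (AddCircle.toCircle θ : ℂ)

/-- The open sector `{α < arg < β}` seen on the universal cover of `ℂ \ {0}`, in the coordinate
`w = log z`; its angle `β - α` may exceed `2π`. -/
def logSector (α β : ℝ) : Set ℂ := {w | α < w.im ∧ w.im < β}

/-- The translation `w ↦ w + log lam + 2πik` of `ℂ`, the universal cover of `ℂ \ {0}` via `exp`,
generates the group whose quotient is the cone of angle `2πk` and dilation factor `lam`. -/
def conePeriod (k : ℕ) (lam : ℝ) : ℂ := Real.log lam + 2 * Real.pi * k * Complex.I

/-- A linear form that is invariant under translation by `conePeriod k lam` and that tends to `-∞`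
exactly when one approaches the apex of the cone. -/
def coneHeight (k : ℕ) (lam : ℝ) (w : ℂ) : ℝ := 2 * Real.pi * k * w.re - Real.log lam * w.im

/-- The subset of the universal cover of the punctured cone that lies over a punctured
neighbourhood of the apex. -/
def coneNhd (k : ℕ) (lam R : ℝ) : Set ℂ := {w | coneHeight k lam w < R}

namespace DilationAtlas

variable {M : Type*} [TopologicalSpace M] {S : Set M}

/-- The action of `SL₂(ℝ)`: every chart is composed with the linear map `A`. -/
def sl2 (A : Matrix.SpecialLinearGroup (Fin 2) ℝ) (D : DilationAtlas M S) :
    DilationAtlas M S where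
  atlas := (fun e => e.transHomeomorph (planeHomeo A)) '' D.atlas
  source_subset := by
    rintro _ ⟨e, he, rfl⟩
    exact D.source_subset e he
  covers := by
    intro x hx
    obtain ⟨e, he, hxe⟩ := D.covers x hx
    exact ⟨_, ⟨e, he, rfl⟩, hxe⟩
  compatible := by
    rintro _ ⟨e, he, rfl⟩ _ ⟨e', he', rfl⟩ x hx
    obtain ⟨a, b, ha, h⟩ := D.compatible e he e' he' x hx
    refine ⟨a, planeHomeo A b, ha, ?_⟩
    filter_upwards [h] with y hy
    change planeHomeo A (e' y) = a * planeHomeo A (e y) + planeHomeo A b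
    rw [hy, planeHomeo_affine]

/-- The Teichmüller flow `g_t`. -/
def teichmullerFlow (t : ℝ) (D : DilationAtlas M S) : DilationAtlas M S :=
  D.sl2 (teichmullerMatrix t)

/-- `ψ : V → M \ S` is continuous and locally a dilation map, where `V ⊆ ℂ` carries the dilation
structure with developing map `f`: in every chart, `ψ` reads locally as `a f + b` with `a > 0`. -/
def IsDilationMapOn (D : DilationAtlas M S) (f : ℂ → ℂ) (V : Set ℂ) (ψ : ℂ → M) : Prop :=
  ContinuousOn ψ V ∧ ∀ w ∈ V, ψ w ∉ S ∧ ∀ e ∈ D.atlas, ψ w ∈ e.source →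
    ∃ (a : ℝ) (b : ℂ), 0 < a ∧ ∀ᶠ w' in 𝓝[V] w, e (ψ w') = a * f w' + b

/-- The structure extends to `s` as a conical-dilation singularity of angle `2πk` and dilation
factor `lam`: a punctured neighbourhood of `s` is isomorphic, as a dilation surface, to a punctured
neighbourhood of the apex in the quotient of the universal cover of `ℂ \ {0}` by
`w ↦ w + conePeriod k lam`. -/
def IsConicalAt (D : DilationAtlas M S) (s : M) (k : ℕ) (lam : ℝ) : Prop :=
  ∃ (R : ℝ) (φ : ℂ → M),
    D.IsDilationMapOn Complex.exp (coneNhd k lam R) φ ∧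
    (∀ w ∈ coneNhd k lam R, ∀ w' ∈ coneNhd k lam R,
      φ w = φ w' ↔ ∃ m : ℤ, w' = w + m * conePeriod k lam) ∧
    Tendsto φ (comap (coneHeight k lam) atBot) (𝓝 s) ∧
    ∀ r ≤ R, insert s (φ '' coneNhd k lam r) ∈ 𝓝 s

/-- Every point of `S` is a conical-dilation singularity of angle `2πk`, `k ≥ 1`, and of dilation
factor `lam > 0`. -/
def IsDilationStructure (D : DilationAtlas M S) : Prop :=
  ∀ s ∈ S, ∃ (k : ℕ) (lam : ℝ), 1 ≤ k ∧ 0 < lam ∧ D.IsConicalAt s k lam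

/-- `M` is obtained from finitely many nondegenerate Euclidean triangles `T i` glued along their
edges, by maps `σ i` from the closed triangles to `M` that preserve the dilation structure away
from the vertices, the set of vertices being exactly `S`. As in the theory of flat surfaces, edges
or vertices of one triangle may be identified with each other. Since vertices go to `S` and all
other points go to the complement of `S`, triangles whose interiors are embedded and disjoint are
automatically glued edge to edge, and edges are geodesic segments. -/
def HasGeodesicTriangulation (D : DilationAtlas M S) : Prop :=
  ∃ (m : ℕ) (T : Fin m → Fin 3 → ℂ) (σ : Fin m → ℂ → M),
    (∀ i, AffineIndependent ℝ (T i)) ∧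
    (∀ i, ContinuousOn (σ i) (convexHull ℝ (range (T i)))) ∧
    (∀ i v, σ i (T i v) ∈ S) ∧
    (∀ i, D.IsDilationMapOn id (convexHull ℝ (range (T i)) \ range (T i)) (σ i)) ∧
    (∀ i j, ∀ z ∈ interior (convexHull ℝ (range (T i))),
      ∀ w ∈ interior (convexHull ℝ (range (T j))), σ i z = σ j w → i = j ∧ z = w) ∧
    ∀ x : M, ∃ i, ∃ z ∈ convexHull ℝ (range (T i)), σ i z = x

/-- `M \ S` contains an embedded dilation cylinder, the quotient of the sector of angles between
`α` and `β` by the dilation of factor `ρ > 1`. -/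
def ContainsCylinder (D : DilationAtlas M S) (α β ρ : ℝ) : Prop :=
  α < β ∧ 1 < ρ ∧ ∃ ψ : ℂ → M,
    D.IsDilationMapOn Complex.exp (logSector α β) ψ ∧
    ∀ w ∈ logSector α β, ∀ w' ∈ logSector α β,
      ψ w = ψ w' ↔ ∃ m : ℤ, w' = w + m * (Real.log ρ : ℂ)

/-- `Θ`: the supremum of the angles of the embedded dilation cylinders (`0` if there are none). -/
def Theta (D : DilationAtlas M S) : ENNReal :=
  ⨆ (α : ℝ) (β : ℝ) (ρ : ℝ) (_ : D.ContainsCylinder α β ρ), ENNReal.ofReal (β - α)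

/-- The curve `c`, on the set `I` of parameters, runs in `M \ S` along a leaf of the directional
foliation in direction `θ`, in the positive sense (with an arbitrary monotone parametrization). -/
def IsLeafCurve (D : DilationAtlas M S) (θ : Direction) (I : Set ℝ) (c : ℝ → M) : Prop :=
  ContinuousOn c I ∧ ∀ t ∈ I, c t ∉ S ∧ ∀ e ∈ D.atlas, c t ∈ e.source →
    ∃ u ∈ 𝓝[I] t, ∀ t₁ ∈ u, ∀ t₂ ∈ u, t₁ < t₂ →
      ∃ r : ℝ, 0 < r ∧ e (c t₂) = e (c t₁) + r * unitVector θ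

/-- `γ` parametrizes, with period `T`, a regular closed leaf in direction `θ`. -/
def IsClosedLeaf (D : DilationAtlas M S) (θ : Direction) (γ : ℝ → M) (T : ℝ) : Prop :=
  0 < T ∧ Function.Periodic γ T ∧ InjOn γ (Ico 0 T) ∧ D.IsLeafCurve θ univ γ

/-- `P` is, on `]-δ, δ[`, the first return map of the foliation in direction `θ` to the segment
`τ (]-ε, ε[)`. -/
def IsFirstReturnMap (D : DilationAtlas M S) (θ : Direction) (τ : ℝ → M) (ε δ : ℝ)
    (P : ℝ → ℝ) : Prop :=
  ∀ s : ℝ, |s| < δ → |P s| < ε ∧ ∃ c : ℝ → M,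
    D.IsLeafCurve θ (Icc 0 1) c ∧ c 0 = τ s ∧ c 1 = τ (P s) ∧
    ∀ t ∈ Ioo (0 : ℝ) 1, ∀ s' : ℝ, |s'| < ε → c t ≠ τ s'

/-- The straight segment through `x`, orthogonal to the direction `θ`, in the chart `e`. -/
def transversal (e : OpenPartialHomeomorph M ℂ) (x : M) (θ : Direction) (s : ℝ) : M :=
  e.symm (e x + s * (Complex.I * unitVector θ))

/-- The closed leaf `γ` is hyperbolic: on a small transverse segment through `γ 0`, the first
return map (which fixes `γ 0`) is contracting or dilating. -/
def IsHyperbolicLeaf (D : DilationAtlas M S) (θ : Direction) (γ : ℝ → M) : Prop :=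
  ∃ e ∈ D.atlas, γ 0 ∈ e.source ∧ ∃ (ε δ : ℝ) (P : ℝ → ℝ), 0 < δ ∧ δ ≤ ε ∧
    (∀ s : ℝ, |s| < ε → e (γ 0) + s * (Complex.I * unitVector θ) ∈ e.target) ∧
    D.IsFirstReturnMap θ (transversal e (γ 0) θ) ε δ P ∧ P 0 = 0 ∧
    ((∃ κ : ℝ, κ < 1 ∧ ∀ s s' : ℝ, |s| < δ → |s'| < δ → |P s - P s'| ≤ κ * |s - s'|) ∨
     (∃ κ : ℝ, 1 < κ ∧ ∀ s s' : ℝ, |s| < δ → |s'| < δ → κ * |s - s'| ≤ |P s - P s'|))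

/-- `𝒞_Σ`: the directions whose foliation has no hyperbolic (regular) closed leaf. -/
def nonHyperbolicDirections (D : DilationAtlas M S) : Set Direction :=
  {θ | ¬ ∃ (γ : ℝ → M) (T : ℝ), D.IsClosedLeaf θ γ T ∧ D.IsHyperbolicLeaf θ γ}

end DilationAtlas

/-- The closed connected orientable surface `M` has genus `g`: its first homology group
`H₁(M, ℤ)`, the abelianized fundamental group, has rank `2g`. -/
def HasGenus (M : Type*) [TopologicalSpace M] (g : ℕ) : Prop :=
  ∀ x : M, Module.finrank ℤ (Additive (Abelianization (FundamentalGroup M x))) = 2 * g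

/-- The dilation atlas `D` on the closed connected surface `M` with marked points
`p 0, …, p (n - 1)` represents a point of the moduli space `ℳ𝒟_{g,n}`. Orientability of `M` follows
from the existence of `D`. -/
structure RepresentsMD {M : Type*} [TopologicalSpace M] (g n : ℕ) (p : Fin n → M)
    (D : DilationAtlas M (range p)) : Prop where
  euler_neg : 2 < 2 * g + n
  genus : HasGenus M g
  marked_injective : Function.Injective p
  conical : D.IsDilationStructure
  triangulable : D.HasGeodesicTriangulation

/-- `x` is a Lebesgue density point of `A ⊆ S¹`, for the arc length measure. -/
def IsDensityPoint (A : Set Direction) (x : Direction) : Prop :=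
  Tendsto (fun r : ℝ => volume (A ∩ Metric.ball x r) / volume (Metric.ball x r))
    (𝓝[>] 0) (𝓝 1)

end Dilation

end

/-! The core curves of a dilation cylinder are closed leaves, and going once around multiplies
transverse distances by `ρ⁻¹`, or by `ρ` for the opposite orientation; so they are hyperbolic. This
survives a linear change of the developing map (`notMem_nonHyperbolicDirections_of_cylinder`), so a
cylinder of `g_t Σ` removes from `𝒞_Σ` the `g_t⁻¹`-images of all directions in its sector.

In terms of the angle `s` from the vertical, `g_t⁻¹` multiplies `tan s` by `e^(-2t)`. If the sector
has angle at least `8h`, it contains a window of length `2h` which, modulo `π`, stays `h` away from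
the horizontal, so that `|tan s| ≤ K = tan (π/2 - h)`. The image of the window is an arc within
distance `e^(-2t) (K + 1)` of the vertical, of length at least a constant times `e^(-2t)`, with a
constant depending only on `h` (`exists_arc_of_containsCylinder`).

If `Θ(g_t Σ)` does not tend to `0`, a single `h` works for arbitrarily large `t`. Hence at
arbitrarily small scales a fixed proportion of the ball about the vertical avoids `𝒞_Σ`
(`not_isDensityPoint_of_frequently`). -/

namespace Dilation

/-! ### Core curves of dilation cylinders are hyperbolic closed leaves. -/

namespace DilationAtlas

variable {M : Type*} [TopologicalSpace M] {S : Set M}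

/-- A dilation map carries a curve whose development moves in direction `θ` to a leaf curve. -/
theorem IsDilationMapOn.isLeafCurve {D : DilationAtlas M S} {f : ℂ → ℂ} {V : Set ℂ} {ψ : ℂ → M}
    (hψ : D.IsDilationMapOn f V ψ) {θ : Direction} {I : Set ℝ} {w : ℝ → ℂ}
    (hw : ContinuousOn w I) (hV : MapsTo w I V)
    (hdir : ∀ t₁ ∈ I, ∀ t₂ ∈ I, t₁ < t₂ →
      ∃ r : ℝ, 0 < r ∧ f (w t₂) - f (w t₁) = r * unitVector θ) :
    D.IsLeafCurve θ I (fun t => ψ (w t)) := by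
  refine ⟨hψ.1.comp hw hV, fun t ht => ⟨(hψ.2 _ (hV ht)).1, fun e he hsrc => ?_⟩⟩
  obtain ⟨a, b, ha, hev⟩ := (hψ.2 _ (hV ht)).2 e he hsrc
  have htend : Tendsto w (𝓝[I] t) (𝓝[V] (w t)) :=
    (hw t ht).tendsto_nhdsWithin hV
  refine ⟨{s | e (ψ (w s)) = a * f (w s) + b} ∩ I,
    inter_mem (htend.eventually hev) self_mem_nhdsWithin, ?_⟩
  rintro t₁ ⟨h₁, hI₁⟩ t₂ ⟨h₂, hI₂⟩ hlt
  obtain ⟨r, hr, hrr⟩ := hdir t₁ hI₁ t₂ hI₂ hlt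
  refine ⟨a * r, mul_pos ha hr, ?_⟩
  simp only [mem_ofPred_eq] at h₁ h₂
  rw [h₁, h₂]
  push_cast
  linear_combination (a : ℂ) * hrr

end DilationAtlas

theorem isOpen_logSector (α β : ℝ) : IsOpen (logSector α β) :=
  (isOpen_lt continuous_const Complex.continuous_im).inter
    (isOpen_lt Complex.continuous_im continuous_const)

theorem add_ofReal_mem_logSector {α β : ℝ} {w : ℂ} (hw : w ∈ logSector α β) (r : ℝ) :
    w + r ∈ logSector α β := by
  simpa [logSector] using hw

theorem affine_pos {ρ t : ℝ} (hρ : 0 < ρ) (ht : t ∈ Icc (0 : ℝ) 1) : 0 < 1 + t * (ρ - 1) := by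
  rcases ht.2.lt_or_eq with h | rfl
  · nlinarith [mul_nonneg ht.1 hρ.le]
  · linarith

/-- A point strictly between `1` and `ρ` is not an integral power of `ρ`. -/
theorem log_affine_ne_int_mul {ρ t : ℝ} (hρ : 0 < ρ) (hρ1 : ρ ≠ 1) (ht : t ∈ Ioo (0 : ℝ) 1)
    (m : ℤ) : Real.log (1 + t * (ρ - 1)) ≠ m * Real.log ρ := by
  intro h
  have hpos := affine_pos hρ (Ioo_subset_Icc_self ht)
  rcases hρ1.lt_or_gt with hlt | hgt
  · have h1 : Real.log ρ < 0 := Real.log_neg hρ hlt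
    have h2 : Real.log (1 + t * (ρ - 1)) < 0 := Real.log_neg hpos (by nlinarith [ht.1])
    have h3 : Real.log ρ < Real.log (1 + t * (ρ - 1)) :=
      Real.log_lt_log hρ (by nlinarith [ht.2])
    rw [h] at h2 h3
    have h4 : (0 : ℝ) < m := by nlinarith
    have h5 : (m : ℝ) < 1 := by nlinarith
    norm_cast at h4 h5
    omega
  · have h1 : 0 < Real.log ρ := Real.log_pos hgt
    have h2 : 0 < Real.log (1 + t * (ρ - 1)) := Real.log_pos (by nlinarith [ht.1])
    have h3 : Real.log (1 + t * (ρ - 1)) < Real.log ρ :=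
      Real.log_lt_log hpos (by nlinarith [ht.2])
    rw [h] at h2 h3
    have h4 : (0 : ℝ) < m := by nlinarith
    have h5 : (m : ℝ) < 1 := by nlinarith
    norm_cast at h4 h5
    omega

/-- Two points `1 + s q + t (ρ - 1)`, `0 < t < 1`, and `1 + s' q` of the plane are not related by a
power of the dilation of factor `ρ`, when `q` is not real. -/
theorem log_strip_ne {ρ t s s' : ℝ} {q : ℂ} (hq : q.im ≠ 0) (hρ : 0 < ρ) (hρ1 : ρ ≠ 1)
    (ht : t ∈ Ioo (0 : ℝ) 1) (m : ℤ) (h₀ : 1 + s * q + t * ((ρ : ℂ) - 1) ≠ 0)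
    (h₁ : 1 + (s' : ℂ) * q ≠ 0) :
    Complex.log (1 + s * q + t * ((ρ : ℂ) - 1)) ≠
      Complex.log (1 + s' * q) + m * (Real.log ρ : ℂ) := by
  intro h
  have hexp := congrArg Complex.exp h
  have hcast : ((m : ℂ) * (Real.log ρ : ℂ)) = ((m * Real.log ρ : ℝ) : ℂ) := by push_cast; ring
  rw [Complex.exp_add, Complex.exp_log h₀, Complex.exp_log h₁, hcast, ← Complex.ofReal_exp] at hexp
  set R := Real.exp (m * Real.log ρ) with hR
  have him := congrArg Complex.im hexp
  have hre := congrArg Complex.re hexp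
  simp at him hre
  -- Imaginary parts give `s = s' R`; the real parts then reduce to `1 + t (ρ - 1) = ρ ^ m`.
  have hs : s = s' * R := mul_right_cancel₀ hq (by linarith)
  have : 1 + t * (ρ - 1) = R := by rw [hs] at hre; linarith
  exact log_affine_ne_int_mul hρ hρ1 ht m (by rw [this, hR, Real.log_exp])

namespace DilationAtlas

variable {M : Type*} [TopologicalSpace M] {S : Set M}

/-- The core curves of an embedded dilation cylinder, developed by `L ∘ exp` for a linear map `L`,
are closed leaves. -/
theorem isClosedLeaf_of_cylinder {D : DilationAtlas M S} {L : ℂ ≃L[ℝ] ℂ} {α β ρ θ₀ c : ℝ}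
    {ψ : ℂ → M} {θ : Direction} (hρ : 0 < ρ) (hρ1 : ρ ≠ 1)
    (hψ : D.IsDilationMapOn (fun w => L (Complex.exp w)) (logSector α β) ψ)
    (hinj : ∀ w ∈ logSector α β, ∀ w' ∈ logSector α β,
      ψ w = ψ w' ↔ ∃ m : ℤ, w' = w + m * (Real.log ρ : ℂ))
    (hθ₀ : θ₀ ∈ Ioo α β) (hc : 0 < c)
    (hθ : unitVector θ = (c * (ρ - 1)) • L (Complex.exp (θ₀ * Complex.I))) :
    D.IsClosedLeaf θ (fun t => ψ (θ₀ * Complex.I + (t * Real.log ρ : ℝ))) 1 := by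
  have hw₀ : (θ₀ * Complex.I : ℂ) ∈ logSector α β := by simpa [logSector] using hθ₀
  have hw : ∀ t : ℝ, (θ₀ * Complex.I + (t * Real.log ρ : ℝ) : ℂ) ∈ logSector α β :=
    fun t => add_ofReal_mem_logSector hw₀ _
  have hlog : Real.log ρ ≠ 0 := Real.log_ne_zero_of_pos_of_ne_one hρ hρ1
  refine ⟨one_pos, fun t => ?_, fun t ht t' ht' h => ?_,
    hψ.isLeafCurve (by fun_prop) (fun t _ => hw t) fun t₁ _ t₂ _ hlt => ?_⟩
  · exact ((hinj _ (hw _) _ (hw _)).2 ⟨1, by push_cast; ring⟩).symm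
  · obtain ⟨m, hm⟩ := (hinj _ (hw _) _ (hw _)).1 h
    have h1 : t' * Real.log ρ = (t + m) * Real.log ρ := by
      have : ((t' * Real.log ρ : ℝ) : ℂ) = (((t + m) * Real.log ρ : ℝ) : ℂ) := by
        push_cast at hm ⊢
        linear_combination hm
      exact_mod_cast this
    have h2 : t' = t + m := mul_right_cancel₀ hlog h1
    have h3 : (m : ℝ) < 1 := by linarith [ht.1, ht'.2]
    have h4 : (-1 : ℝ) < m := by linarith [ht.2, ht'.1]
    have h5 : m = 0 := by
      have h3' : m < 1 := by exact_mod_cast h3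
      have h4' : -1 < m := by exact_mod_cast h4
      omega
    simp [h2, h5]
  -- The core curve develops to `ρ ^ t • L (e^(iθ₀))`, whose increments have the sign of `ρ - 1`, as
  -- does the factor in `hθ`.
  · have hd : 0 < (Real.exp (t₂ * Real.log ρ) - Real.exp (t₁ * Real.log ρ)) / (ρ - 1) := by
      rcases hρ1.lt_or_gt with h | h
      · refine div_pos_of_neg_of_neg (sub_neg.2 (Real.exp_lt_exp.2 ?_)) (by linarith)
        exact mul_lt_mul_of_neg_right hlt (Real.log_neg hρ h)
      · refine div_pos (sub_pos.2 (Real.exp_lt_exp.2 ?_)) (by linarith)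
        exact mul_lt_mul_of_pos_right hlt (Real.log_pos h)
    refine ⟨_, div_pos hd hc, ?_⟩
    have key : ∀ t : ℝ, L (Complex.exp (θ₀ * Complex.I + (t * Real.log ρ : ℝ))) =
        Real.exp (t * Real.log ρ) • L (Complex.exp (θ₀ * Complex.I)) := fun t => by
      rw [Complex.exp_add, ← Complex.ofReal_exp, mul_comm, ← Complex.real_smul, map_smul]
    have h1 : (ρ : ℂ) - 1 ≠ 0 := by exact_mod_cast sub_ne_zero.2 hρ1
    have hc' : (c : ℂ) ≠ 0 := by exact_mod_cast hc.ne'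
    rw [key, key, hθ]
    simp only [Complex.real_smul, Complex.ofReal_mul, Complex.ofReal_div, Complex.ofReal_sub,
      Complex.ofReal_one]
    field_simp

/-- The core curves of an embedded dilation cylinder are hyperbolic: the first return map to an
orthogonal segment is `s ↦ s / ρ`. -/
theorem isHyperbolicLeaf_of_cylinder {D : DilationAtlas M S} {L : ℂ ≃L[ℝ] ℂ} {α β ρ θ₀ c : ℝ}
    {ψ : ℂ → M} {θ : Direction} (hρ : 0 < ρ) (hρ1 : ρ ≠ 1)
    (hψ : D.IsDilationMapOn (fun w => L (Complex.exp w)) (logSector α β) ψ)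
    (hinj : ∀ w ∈ logSector α β, ∀ w' ∈ logSector α β,
      ψ w = ψ w' ↔ ∃ m : ℤ, w' = w + m * (Real.log ρ : ℂ))
    (hθ₀ : θ₀ ∈ Ioo α β) (hc : 0 < c)
    (hθ : unitVector θ = (c * (ρ - 1)) • L (Complex.exp (θ₀ * Complex.I)))
    {γ : ℝ → M} (hγ : γ 0 = ψ (θ₀ * Complex.I)) :
    D.IsHyperbolicLeaf θ γ := by
  set w₀ : ℂ := θ₀ * Complex.I with hw₀def
  have hw₀ : w₀ ∈ logSector α β := by simpa [logSector, hw₀def] using hθ₀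
  have hVo := isOpen_logSector α β
  have hv : unitVector θ ≠ 0 := by simp [unitVector]
  have hρ1' : ρ - 1 ≠ 0 := sub_ne_zero.2 hρ1
  obtain ⟨e, he, hsrc⟩ := D.covers _ (hψ.2 _ hw₀).1
  obtain ⟨a, b, ha, hev⟩ := (hψ.2 _ hw₀).2 e he hsrc
  rw [hVo.nhdsWithin_eq hw₀] at hev
  -- `q` is chosen so that moving from `e^w₀` to `e^w₀ (1 + s q)` shifts the chart value by `s`
  -- times the unit normal to the leaf.
  set q : ℂ := Complex.exp (-w₀) * L.symm (a⁻¹ • (Complex.I * unitVector θ)) with hqdef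
  have hLq : L (Complex.exp w₀ * q) = a⁻¹ • (Complex.I * unitVector θ) := by
    rw [hqdef, ← mul_assoc, ← Complex.exp_add, add_neg_cancel, Complex.exp_zero, one_mul,
      L.apply_symm_apply]
  -- For real `q`, the normal `i u` would be a real multiple of `u`.
  have hq : q.im ≠ 0 := by
    intro h0
    have hqr : q = (q.re : ℂ) := Complex.ext (by simp) (by simpa using h0)
    have h1 : q.re • L (Complex.exp w₀) = a⁻¹ • (Complex.I * unitVector θ) := by
      rw [← map_smul, Complex.real_smul, ← hqr, mul_comm, hLq]
    have h2 : ((a⁻¹ * (c * (ρ - 1)) : ℝ) : ℂ) * (Complex.I * unitVector θ) =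
        (q.re : ℂ) * unitVector θ := by
      simp only [Complex.real_smul] at h1
      conv_rhs => rw [hθ]
      simp only [Complex.real_smul, Complex.ofReal_mul]
      linear_combination (-(c * (ρ - 1 : ℝ)) : ℂ) * h1
    rw [← mul_assoc] at h2
    have h3 := congrArg Complex.im (mul_right_cancel₀ hv h2)
    have h4 : a⁻¹ * (c * (ρ - 1)) ≠ 0 := by positivity
    rw [Complex.im_ofReal_mul, Complex.I_im, Complex.ofReal_im, mul_one] at h3
    exact h4 h3
  -- the developed strip of leaves, and the conditions under which it lifts to the cylinder
  let U : Set ℂ := Complex.slitPlane ∩ (fun z => w₀ + Complex.log z) ⁻¹' logSector α β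
  have hUo : IsOpen U := by
    refine ContinuousOn.isOpen_inter_preimage (fun z hz => ?_) Complex.isOpen_slitPlane hVo
    exact (continuousAt_const.add (Complex.differentiableAt_log hz).continuousAt).continuousWithinAt
  have hUpos : ∀ x : ℝ, 0 < x → (x : ℂ) ∈ U := fun x hx =>
    ⟨Complex.ofReal_mem_slitPlane.2 hx, by
      rw [mem_preimage, ← Complex.ofReal_log hx.le]
      exact add_ofReal_mem_logSector hw₀ _⟩
  -- At `s = 0` the strip is the real segment from `1` to `ρ`, which lies in `U`; compactness of
  -- `[0, 1]` gives a bound on `s` uniform in `t`.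
  have hstrip : ∀ᶠ s : ℝ in 𝓝 0, ∀ t ∈ Icc (0 : ℝ) 1, 1 + s * q + t * ((ρ : ℂ) - 1) ∈ U := by
    refine isCompact_Icc.eventually_forall_of_forall_eventually fun t ht => ?_
    have hcont : Continuous fun z : ℝ × ℝ => 1 + (z.1 : ℂ) * q + z.2 * ((ρ : ℂ) - 1) := by fun_prop
    refine hcont.continuousAt.eventually (hUo.mem_nhds ?_)
    have := hUpos _ (affine_pos hρ ht)
    push_cast at this
    simpa using this
  have hchart : ∀ᶠ s : ℝ in 𝓝 0, ψ (w₀ + Complex.log (1 + s * q)) ∈ e.source ∧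
      e (ψ (w₀ + Complex.log (1 + s * q))) = a * L (Complex.exp (w₀ + Complex.log (1 + s * q))) + b := by
    have htend : Tendsto (fun s : ℝ => w₀ + Complex.log (1 + s * q)) (𝓝 0) (𝓝 w₀) := by
      have h1 : ContinuousAt (fun s : ℝ => w₀ + Complex.log (1 + s * q)) 0 := by
        refine continuousAt_const.add (ContinuousAt.clog (by fun_prop) ?_)
        simp
      simpa [ContinuousAt] using h1
    have hsrc' : ∀ᶠ w in 𝓝 w₀, ψ w ∈ e.source :=
      (hψ.1.continuousAt (hVo.mem_nhds hw₀)).eventually (e.open_source.mem_nhds hsrc)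
    exact (htend.eventually hsrc').and (htend.eventually hev)
  obtain ⟨ε, hε, hball⟩ := Metric.eventually_nhds_iff.1 (hstrip.and hchart)
  simp only [Real.dist_eq, sub_zero] at hball
  have hU : ∀ s : ℝ, |s| < ε → 1 + (s : ℂ) * q ∈ U := fun s hs => by
    simpa using (hball hs).1 0 (by simp)
  have hW : ∀ s : ℝ, |s| < ε → e (ψ (w₀ + Complex.log (1 + s * q))) =
      e (γ 0) + s * (Complex.I * unitVector θ) := by
    intro s hs
    have h0 := hev.self_of_nhds
    rw [hγ, (hball hs).2.2, h0, Complex.exp_add,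
      Complex.exp_log (Complex.slitPlane_ne_zero (hU s hs).1)]
    have : Complex.exp w₀ * (1 + s * q) = Complex.exp w₀ + s • (Complex.exp w₀ * q) := by
      rw [Complex.real_smul]; ring
    rw [this, map_add, map_smul, hLq]
    have ha' : (a : ℂ) ≠ 0 := by exact_mod_cast ha.ne'
    simp only [Complex.real_smul, Complex.ofReal_inv]
    field_simp
    ring
  have hτ : ∀ s : ℝ, |s| < ε → transversal e (γ 0) θ s = ψ (w₀ + Complex.log (1 + s * q)) := by
    intro s hs
    rw [transversal, ← hW s hs, e.left_inv (hball hs).2.1]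
  -- The radius `min ε (ε * ρ)` keeps both `s` and its return `s / ρ` in the transversal, whether `ρ
  -- < 1` or `ρ > 1`.
  refine ⟨e, he, hγ ▸ hsrc, ε, min ε (ε * ρ), fun s => s / ρ, by positivity, min_le_left _ _,
    fun s hs => hW s hs ▸ e.map_source (hball hs).2.1, fun s hs => ?_, by simp, ?_⟩
  · have hsε : |s| < ε := hs.trans_le (min_le_left _ _)
    have hsρ : |s / ρ| < ε := by
      rw [abs_div, abs_of_pos hρ, div_lt_iff₀ hρ]
      exact hs.trans_le (min_le_right _ _)
    have hUt := (hball hsε).1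
    refine ⟨hsρ, fun t => ψ (w₀ + Complex.log (1 + s * q + t * ((ρ : ℂ) - 1))),
      hψ.isLeafCurve ?_ (fun t ht => (hUt t ht).2) fun t₁ h₁ t₂ h₂ hlt => ?_, ?_, ?_, ?_⟩
    · exact continuousOn_const.add (ContinuousOn.clog (by fun_prop) fun t ht => (hUt t ht).1)
    · refine ⟨(t₂ - t₁) / c, div_pos (sub_pos.2 hlt) hc, ?_⟩
      simp only [Complex.exp_add]
      rw [Complex.exp_log (Complex.slitPlane_ne_zero (hUt _ h₁).1),
        Complex.exp_log (Complex.slitPlane_ne_zero (hUt _ h₂).1), ← map_sub, hθ]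
      have hdiff : Complex.exp w₀ * (1 + s * q + t₂ * ((ρ : ℂ) - 1)) -
          Complex.exp w₀ * (1 + s * q + t₁ * ((ρ : ℂ) - 1)) =
          ((t₂ - t₁) * (ρ - 1)) • Complex.exp w₀ := by
        simp only [Complex.real_smul]
        push_cast
        ring
      have hc' : (c : ℂ) ≠ 0 := by exact_mod_cast hc.ne'
      rw [hdiff, map_smul]
      simp only [Complex.real_smul]
      push_cast
      field_simp
    · simp [hτ s hsε]
    · rw [hτ _ hsρ]
      -- At time `1` the leaf reaches `ρ (1 + (s / ρ) q)`, which the deck group identifies with the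
      -- point `s / ρ` of the transversal.
      have hfac : 1 + s * q + (1 : ℝ) * ((ρ : ℂ) - 1) = (ρ : ℂ) * (1 + (s / ρ : ℝ) * q) := by
        have : (ρ : ℂ) ≠ 0 := by exact_mod_cast hρ.ne'
        push_cast
        field_simp
        ring
      refine ((hinj _ (hU _ hsρ).2 _ (hUt 1 (by simp)).2).2 ⟨1, ?_⟩).symm
      simp only
      rw [hfac, Complex.log_ofReal_mul hρ (Complex.slitPlane_ne_zero (hU _ hsρ).1)]
      push_cast
      ring
    · intro t ht s' hs' heq
      rw [hτ s' hs'] at heq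
      have htI := Ioo_subset_Icc_self ht
      obtain ⟨m, hm⟩ := (hinj _ (hU _ hs').2 _ (hUt t htI).2).1 heq.symm
      refine log_strip_ne hq hρ hρ1 ht m (Complex.slitPlane_ne_zero (hUt t htI).1)
        (Complex.slitPlane_ne_zero (hU _ hs').1) ?_
      simp only at hm
      linear_combination hm
  · have hdiff : ∀ s s' : ℝ, |s / ρ - s' / ρ| = ρ⁻¹ * |s - s'| := fun s s' => by
      rw [← sub_div, abs_div, abs_of_pos hρ, div_eq_inv_mul]
    rcases hρ1.lt_or_gt with h | h
    · exact Or.inr ⟨ρ⁻¹, (one_lt_inv₀ hρ).2 h, fun s s' _ _ => (hdiff s s').ge⟩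
    · exact Or.inl ⟨ρ⁻¹, inv_lt_one_of_one_lt₀ h, fun s s' _ _ => (hdiff s s').le⟩

/-- The directions of the core curves of an embedded dilation cylinder, and the opposite ones,
have hyperbolic closed leaves. -/
theorem notMem_nonHyperbolicDirections_of_cylinder {D : DilationAtlas M S} {L : ℂ ≃L[ℝ] ℂ}
    {α β ρ θ₀ k : ℝ} {ψ : ℂ → M} {θ : Direction} (hρ : 1 < ρ)
    (hψ : D.IsDilationMapOn (fun w => L (Complex.exp w)) (logSector α β) ψ)
    (hinj : ∀ w ∈ logSector α β, ∀ w' ∈ logSector α β,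
      ψ w = ψ w' ↔ ∃ m : ℤ, w' = w + m * (Real.log ρ : ℂ))
    (hθ₀ : θ₀ ∈ Ioo α β) (hk : k ≠ 0)
    (hθ : unitVector θ = k • L (Complex.exp (θ₀ * Complex.I))) :
    θ ∉ D.nonHyperbolicDirections := by
  -- For `k < 0`, the factor `ρ⁻¹` describes the same cylinder and turns the core curve around.
  obtain ⟨r, hr, hr1, hrinj, c, hc, hck⟩ : ∃ r : ℝ, 0 < r ∧ r ≠ 1 ∧
      (∀ w ∈ logSector α β, ∀ w' ∈ logSector α β,
        ψ w = ψ w' ↔ ∃ m : ℤ, w' = w + m * (Real.log r : ℂ)) ∧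
      ∃ c : ℝ, 0 < c ∧ k = c * (r - 1) := by
    have hρ0 : 0 < ρ := one_pos.trans hρ
    rcases hk.lt_or_gt with h | h
    · have h1 : ρ⁻¹ < 1 := inv_lt_one_of_one_lt₀ hρ
      refine ⟨ρ⁻¹, inv_pos.2 hρ0, h1.ne, fun w hw w' hw' => (hinj w hw w' hw').trans ?_,
        k / (ρ⁻¹ - 1), div_pos_of_neg_of_neg h (by linarith), ?_⟩
      · constructor <;> rintro ⟨m, rfl⟩ <;> exact ⟨-m, by simp [Real.log_inv]⟩
      · rw [div_mul_cancel₀]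
        linarith
    · refine ⟨ρ, hρ0, hρ.ne', hinj, k / (ρ - 1), div_pos h (by linarith), ?_⟩
      rw [div_mul_cancel₀]
      linarith
  rw [hck] at hθ
  exact fun hmem => hmem ⟨_, 1, isClosedLeaf_of_cylinder hr hr1 hψ hrinj hθ₀ hc hθ,
    isHyperbolicLeaf_of_cylinder hr hr1 hψ hrinj hθ₀ hc hθ (by simp)⟩

end DilationAtlas

/-! ### The action of the flow on cylinders and directions. -/

/-- The inverse of the linear action of `A` on the plane. -/
noncomputable def planeInv (A : Matrix.SpecialLinearGroup (Fin 2) ℝ) : ℂ ≃L[ℝ] ℂ where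
  toFun := (planeHomeo A).symm
  invFun := planeHomeo A
  map_add' z w := by apply Complex.ext <;> simp [planeHomeo] <;> ring
  map_smul' r z := by apply Complex.ext <;> simp [planeHomeo] <;> ring
  left_inv := (planeHomeo A).right_inv
  right_inv := (planeHomeo A).left_inv
  continuous_toFun := (planeHomeo A).symm.continuous
  continuous_invFun := (planeHomeo A).continuous

theorem planeInv_planeHomeo (A : Matrix.SpecialLinearGroup (Fin 2) ℝ) (z : ℂ) :
    planeInv A (planeHomeo A z) = z :=
  (planeHomeo A).symm_apply_apply z

theorem planeInv_teichmullerMatrix (t : ℝ) (z : ℂ) :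
    planeInv (teichmullerMatrix t) z = ⟨Real.exp (-t) * z.re, Real.exp t * z.im⟩ := by
  apply Complex.ext <;> simp [planeInv, planeHomeo, teichmullerMatrix]

/-- Applying `A⁻¹` to the chart identity moves the linear map from the charts to the developing map;
this is where the `L` of the cylinder lemmas comes from. -/
theorem DilationAtlas.IsDilationMapOn.of_sl2 {M : Type*} [TopologicalSpace M] {S : Set M}
    {D : DilationAtlas M S} {A : Matrix.SpecialLinearGroup (Fin 2) ℝ} {f : ℂ → ℂ} {V : Set ℂ}
    {ψ : ℂ → M} (h : (D.sl2 A).IsDilationMapOn f V ψ) :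
    D.IsDilationMapOn (fun w => planeInv A (f w)) V ψ := by
  refine ⟨h.1, fun w hw => ⟨(h.2 w hw).1, fun e he hsrc => ?_⟩⟩
  obtain ⟨a, b, ha, hev⟩ := (h.2 w hw).2 (e.transHomeomorph (planeHomeo A)) ⟨e, he, rfl⟩ hsrc
  refine ⟨a, planeInv A b, ha, hev.mono fun w' hw' => ?_⟩
  have h1 : planeHomeo A (e (ψ w')) = a * f w' + b := hw'
  rw [← planeInv_planeHomeo A (e (ψ w')), h1, map_add, ← Complex.real_smul, map_smul,
    Complex.real_smul]

theorem unitVector_coe (x : ℝ) : unitVector (x : Direction) = Complex.exp (x * Complex.I) := by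
  rw [unitVector, AddCircle.toCircle_apply_mk, Circle.coe_exp,
    div_self Real.two_pi_pos.ne', one_mul]

/-- The inverse Teichmüller flow contracts, up to sign, the directions of angle `π / 2 - s` towards
the vertical one. -/
theorem unitVector_eq_smul_planeInv {t s y : ℝ} (k : ℤ) (hs : Real.cos s ≠ 0)
    (hy : Real.cos y ≠ 0) (h : Real.tan y = Real.exp (-2 * t) * Real.tan s) :
    ∃ c : ℝ, c ≠ 0 ∧ unitVector ((Real.pi / 2 - y : ℝ) : Direction) =
      c • planeInv (teichmullerMatrix t)
        (Complex.exp ((Real.pi / 2 - s + k * Real.pi : ℝ) * Complex.I)) := by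
  have hsign : ((-1 : ℝ) ^ k) * (-1) ^ k = 1 := by
    rw [← mul_zpow]; simp
  have hsign0 : ((-1 : ℝ) ^ k) ≠ 0 := zpow_ne_zero _ (by norm_num)
  -- The image is `(-1)^k (e^(-t) sin s, e^t cos s)`; this scalar normalizes it to `(sin y, cos y)`.
  refine ⟨(-1) ^ k * (Real.cos y / Real.cos s * Real.exp (-t)), by
    have := (Real.exp_pos (-t)).ne'
    positivity, ?_⟩
  rw [unitVector_coe, planeInv_teichmullerMatrix]
  have hee : Real.exp (-t) * Real.exp t = 1 := by rw [← Real.exp_add]; simp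
  have he2 : Real.exp (-t) * Real.exp (-t) = Real.exp (-2 * t) := by rw [← Real.exp_add]; ring_nf
  rw [Real.tan_eq_sin_div_cos, Real.tan_eq_sin_div_cos] at h
  have hsin : Real.sin y = Real.exp (-2 * t) * (Real.sin s / Real.cos s) * Real.cos y := by
    rw [← h, div_mul_cancel₀ _ hy]
  apply Complex.ext
  · rw [Complex.smul_re, smul_eq_mul, Complex.exp_ofReal_mul_I_re, Complex.exp_ofReal_mul_I_re,
      Real.cos_add_int_mul_pi, Real.cos_pi_div_two_sub, Real.cos_pi_div_two_sub, hsin, ← he2]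
    linear_combination (-(Real.exp (-t) * Real.exp (-t) * (Real.sin s / Real.cos s) *
      Real.cos y)) * hsign
  · rw [Complex.smul_im, smul_eq_mul, Complex.exp_ofReal_mul_I_im, Complex.exp_ofReal_mul_I_im,
      Real.sin_add_int_mul_pi, Real.sin_pi_div_two_sub, Real.sin_pi_div_two_sub]
    have : Real.cos y = Real.cos y / Real.cos s * Real.cos s := (div_mul_cancel₀ _ hs).symm
    linear_combination this - (Real.cos y / Real.cos s * Real.cos s) *
      (hsign * (Real.exp (-t) * Real.exp t) + hee)

/-! ### Choice of a window and estimates for `arctan`. -/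

/-- An interval of length at least `8 h` contains one of length `2 h` that stays at distance `h`
from the multiples of `π`. -/
theorem exists_subinterval_avoiding_pi_multiples {α β h : ℝ} (hh : 0 < h)
    (hhπ : 8 * h ≤ Real.pi) (hαβ : 8 * h ≤ β - α) :
    ∃ (k : ℤ) (s : ℝ), -(Real.pi / 2 - h) ≤ s - h ∧ s + h ≤ Real.pi / 2 - h ∧
      ∀ s' ∈ Icc (s - h) (s + h), Real.pi / 2 - s' + k * Real.pi ∈ Ioo α β := by
  have hπ := Real.pi_pos
  have h1 := Int.floor_le (α / Real.pi)
  have h2 := Int.lt_floor_add_one (α / Real.pi)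
  rw [le_div_iff₀ hπ] at h1
  rw [div_lt_iff₀ hπ] at h2
  set n := ⌊α / Real.pi⌋
  -- Modulo `π`, `α` lies in `[0, π)`. Unless it is within `4h` of `π`, the window is centred at `α
  -- + 2h`; otherwise at `α + 6h`, past the multiple of `π`.
  by_cases hc : α - n * Real.pi ≤ Real.pi - 4 * h
  · refine ⟨n, Real.pi / 2 + n * Real.pi - (α + 2 * h), by linarith, by linarith, ?_⟩
    rintro s' ⟨h3, h4⟩
    constructor <;> linarith
  · refine ⟨n + 1, Real.pi / 2 + (n + 1) * Real.pi - (α + 6 * h), by linarith, by linarith, ?_⟩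
    rintro s' ⟨h3, h4⟩
    push_cast
    constructor <;> linarith

theorem arctan_sub_arctan_le {a b : ℝ} (hab : a ≤ b) :
    Real.arctan b - Real.arctan a ≤ b - a := by
  have := image_sub_le_mul_sub_of_deriv_le (f := Real.arctan) (C := 1)
    Real.differentiable_arctan (fun x => by
      rw [Real.deriv_arctan]
      exact (div_le_one (by positivity)).2 (by nlinarith [sq_nonneg x])) hab
  linarith

/-- The derivative `1 / (1 + x²)` is at least `1 / (1 + K²)` on `[-K, K]`. This bounds from below
the length of the contracted arc. -/
theorem le_arctan_sub_arctan {a b K : ℝ} (hab : a ≤ b) (ha : -K ≤ a) (hb : b ≤ K) :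
    (b - a) / (1 + K ^ 2) ≤ Real.arctan b - Real.arctan a := by
  have := (convex_Icc (-K) K).mul_sub_le_image_sub_of_le_deriv (f := Real.arctan)
    (C := 1 / (1 + K ^ 2)) Real.continuous_arctan.continuousOn
    Real.differentiable_arctan.differentiableOn (fun x hx => by
      rw [interior_Icc] at hx
      rw [Real.deriv_arctan]
      exact one_div_le_one_div_of_le (by positivity) (by nlinarith [hx.1, hx.2]))
    a ⟨ha, hab.trans hb⟩ b ⟨ha.trans hab, hb⟩ hab
  rwa [div_eq_inv_mul, ← one_div]

theorem abs_arctan_le (x : ℝ) : |Real.arctan x| ≤ |x| := by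
  rcases le_total 0 x with h | h
  · have := arctan_sub_arctan_le h
    have h0 := Real.arctan_nonneg.2 h
    rw [abs_of_nonneg h, abs_of_nonneg h0]
    simpa using this
  · have := arctan_sub_arctan_le h
    have h0 : Real.arctan x ≤ 0 := by simpa using Real.arctan_strictMono.monotone h
    rw [abs_of_nonpos h, abs_of_nonpos h0]
    simpa using this

/-! ### Arcs of the circle and density points. -/

theorem exists_lift_of_mem_closedBall {c j : ℝ} {z : Direction}
    (hz : z ∈ Metric.closedBall (c : Direction) j) : ∃ y : ℝ, |y - c| ≤ j ∧ (y : Direction) = z := by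
  obtain ⟨z', rfl⟩ := QuotientAddGroup.mk_surjective z
  have h : z' ∈ ((↑) : ℝ → Direction) ⁻¹' Metric.closedBall (c : Direction) j := hz
  rw [AddCircle.coe_real_preimage_closedBall_eq_iUnion] at h
  obtain ⟨k, hk⟩ := mem_iUnion.1 h
  rw [Metric.mem_closedBall, Real.dist_eq] at hk
  refine ⟨z' - k • (2 * Real.pi), by rwa [sub_sub, add_comm], ?_⟩
  rw [AddCircle.coe_sub, AddCircle.coe_zsmul, AddCircle.coe_period, smul_zero, sub_zero]

/-- A set is not dense at `x` if arbitrarily small balls about `x` contain in its complement an arc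
of comparable length. -/
theorem not_isDensityPoint_of_frequently {A : Set Direction} {x : Direction} {η : ℝ} (hη : 0 < η)
    (h : ∃ᶠ r in 𝓝[>] (0 : ℝ), ∃ z : Direction,
      Metric.closedBall z (η * r) ⊆ Metric.ball x r \ A) : ¬ IsDensityPoint A x := by
  intro hd
  have hπ := Real.pi_pos
  have hd' := (ENNReal.tendsto_toReal ENNReal.one_ne_top).comp hd
  have hev : ∀ᶠ r in 𝓝[>] (0 : ℝ), 1 - η <
      (volume (A ∩ Metric.ball x r) / volume (Metric.ball x r)).toReal :=
    hd'.eventually (eventually_gt_nhds (by simpa using hη))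
  -- Neither ball wraps around the circle, so their lengths are exactly `2r` and `2ηr`.
  have hsmall : ∀ᶠ r in 𝓝[>] (0 : ℝ), r < Real.pi ∧ r < Real.pi / η :=
    nhdsWithin_le_nhds ((eventually_lt_nhds hπ).and (eventually_lt_nhds (by positivity)))
  obtain ⟨r, ⟨z, hz⟩, h1, ⟨h2, h3⟩, hr⟩ :=
    (h.and_eventually (hev.and (hsmall.and self_mem_nhdsWithin))).exists
  have hr : 0 < r := hr
  rw [lt_div_iff₀ hη] at h3
  have hball : volume.real (Metric.ball x r) = 2 * r := by
    rw [measureReal_def, ← measure_congr (AddCircle.closedBall_ae_eq_ball (x := x) (ε := r)),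
      AddCircle.volume_closedBall, min_eq_right (by linarith),
      ENNReal.toReal_ofReal (by positivity)]
  have harc : volume.real (Metric.closedBall z (η * r)) = 2 * (η * r) := by
    rw [measureReal_def, AddCircle.volume_closedBall, min_eq_right (by linarith),
      ENNReal.toReal_ofReal (by positivity)]
  have hsub : A ∩ Metric.ball x r ⊆ Metric.ball x r \ Metric.closedBall z (η * r) :=
    fun y hy => ⟨hy.2, fun hyz => (hz hyz).2 hy.1⟩
  have hle : volume.real (A ∩ Metric.ball x r) ≤ 2 * r - 2 * (η * r) := by
    refine (measureReal_mono hsub).trans ?_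
    rw [measureReal_sdiff (fun y hy => (hz hy).1) Metric.isClosed_closedBall.measurableSet,
      hball, harc]
  rw [ENNReal.toReal_div, ← measureReal_def, ← measureReal_def, hball,
    lt_div_iff₀ (by positivity)] at h1
  linarith

/-! ### From wide cylinders to arcs near the vertical, and the conclusion. -/

/-- A cylinder of the surface `g_t Σ` gives an arc of directions of `Σ` with hyperbolic closed
leaves, near the vertical direction, and of length comparable to its distance to it. -/
theorem exists_arc_of_containsCylinder {M : Type*} [TopologicalSpace M] {S : Set M}
    {D : DilationAtlas M S} {t α β ρ h : ℝ} (ht : 0 ≤ t) (hh : 0 < h) (hhπ : 8 * h ≤ Real.pi)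
    (hαβ : 8 * h ≤ β - α) (hcyl : (D.teichmullerFlow t).ContainsCylinder α β ρ) {K : ℝ}
    (hK : K = Real.tan (Real.pi / 2 - h)) :
    ∃ z : Direction, Metric.closedBall z (h / ((1 + K ^ 2) * (K + 1)) *
        (Real.exp (-2 * t) * (K + 1))) ⊆
      Metric.ball ((Real.pi / 2 : ℝ) : Direction) (Real.exp (-2 * t) * (K + 1)) \
        D.nonHyperbolicDirections := by
  have hπ := Real.pi_pos
  obtain ⟨-, hρ, ψ, hψ, hinj⟩ := hcyl
  replace hψ := DilationAtlas.IsDilationMapOn.of_sl2 hψ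
  obtain ⟨k, s, hs1, hs2, hwin⟩ := exists_subinterval_avoiding_pi_multiples hh hhπ hαβ
  set x := Real.exp (-2 * t) with hx
  have hx0 : 0 < x := Real.exp_pos _
  have hx1 : x ≤ 1 := Real.exp_le_one_iff.2 (by linarith)
  have hK0 : 0 < K := hK ▸ Real.tan_pos_of_pos_of_lt_pi_div_two (by linarith) (by linarith)
  have harc : ∀ u ∈ Icc (-(Real.pi / 2 - h)) (Real.pi / 2 - h),
      Real.arctan (Real.tan u) = u ∧ |Real.tan u| ≤ K := fun u hu => by
    have hmem : ∀ v ∈ Icc (-(Real.pi / 2 - h)) (Real.pi / 2 - h),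
        v ∈ Ioo (-(Real.pi / 2)) (Real.pi / 2) := fun v hv =>
      ⟨by linarith [hv.1], by linarith [hv.2]⟩
    have hmono := Real.strictMonoOn_tan.monotoneOn
    refine ⟨Real.arctan_tan (hmem u hu).1 (hmem u hu).2, abs_le.2 ⟨?_, ?_⟩⟩
    · rw [hK, ← Real.tan_neg]
      exact hmono (hmem _ ⟨le_rfl, by linarith⟩) (hmem u hu) hu.1
    · rw [hK]
      exact hmono (hmem u hu) (hmem _ ⟨by linarith, le_rfl⟩) hu.2
  obtain ⟨ha1, hK1⟩ := harc (s - h) ⟨hs1, by linarith⟩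
  obtain ⟨ha2, hK2⟩ := harc (s + h) ⟨by linarith, hs2⟩
  set v₁ := Real.tan (s - h)
  set v₂ := Real.tan (s + h)
  have hv : v₁ ≤ v₂ := Real.arctan_strictMono.le_iff_le.1 (by rw [ha1, ha2]; linarith)
  have hv2 : 2 * h ≤ v₂ - v₁ := by
    have := arctan_sub_arctan_le hv
    rw [ha1, ha2] at this
    linarith
  rw [abs_le] at hK1 hK2
  have hxK : x * K ≤ K := by nlinarith
  have hlow : x * (2 * h) / (1 + K ^ 2) ≤ Real.arctan (x * v₂) - Real.arctan (x * v₁) := by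
    refine le_trans ?_ (le_arctan_sub_arctan (K := K) (by gcongr) (by nlinarith) (by nlinarith))
    gcongr
    nlinarith
  refine ⟨((Real.pi / 2 - (Real.arctan (x * v₁) + Real.arctan (x * v₂)) / 2 : ℝ) : Direction),
    fun z hz => ?_⟩
  obtain ⟨y', hy', rfl⟩ := exists_lift_of_mem_closedBall hz
  obtain ⟨y, rfl⟩ : ∃ y, y' = Real.pi / 2 - y := ⟨Real.pi / 2 - y', by ring⟩
  -- The radius is half of the lower bound `hlow`, so the ball about the midpoint stays inside the
  -- arc.
  have hrad : h / ((1 + K ^ 2) * (K + 1)) * (x * (K + 1)) = x * (2 * h) / (1 + K ^ 2) / 2 := by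
    field_simp
  rw [hrad, abs_le] at hy'
  have hy1 : Real.arctan (x * v₁) ≤ y := by linarith [hy'.2]
  have hy2 : y ≤ Real.arctan (x * v₂) := by linarith [hy'.1]
  have hyπ1 : -(Real.pi / 2) < y := (Real.neg_pi_div_two_lt_arctan _).trans_le hy1
  have hyπ2 : y < Real.pi / 2 := hy2.trans_lt (Real.arctan_lt_pi_div_two _)
  -- `arctan w` is the angle from the vertical before contraction; it lies in the window since `v₁ ≤
  -- w ≤ v₂`.
  obtain ⟨w, rfl⟩ : ∃ w, y = Real.arctan (x * w) :=
    ⟨Real.tan y / x, by rw [mul_div_cancel₀ _ hx0.ne', Real.arctan_tan hyπ1 hyπ2]⟩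
  have hw1 : v₁ ≤ w := le_of_mul_le_mul_left (Real.arctan_strictMono.le_iff_le.1 hy1) hx0
  have hw2 : w ≤ v₂ := le_of_mul_le_mul_left (Real.arctan_strictMono.le_iff_le.1 hy2) hx0
  constructor
  · rw [Metric.mem_ball, dist_eq_norm, ← AddCircle.coe_sub, sub_sub_cancel_left]
    have hle : |-Real.arctan (x * w)| ≤ |2 * Real.pi| / 2 := by
      rw [abs_neg, abs_of_pos Real.two_pi_pos, abs_le]
      constructor <;> linarith
    rw [(AddCircle.norm_coe_eq_abs_iff _ Real.two_pi_pos.ne').2 hle, abs_neg]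
    refine (abs_arctan_le _).trans_lt ?_
    rw [abs_mul, abs_of_pos hx0]
    -- The `+ 1` in the radius makes the inequality strict, as the open ball requires.
    have : |w| ≤ K := abs_le.2 ⟨by linarith, by linarith⟩
    gcongr
    linarith
  · have hθ₀ := hwin (Real.arctan w)
      ⟨ha1 ▸ Real.arctan_strictMono.monotone hw1, ha2 ▸ Real.arctan_strictMono.monotone hw2⟩
    obtain ⟨c, hc, hcu⟩ := unitVector_eq_smul_planeInv (t := t) k (Real.cos_arctan_pos w).ne'
      (Real.cos_arctan_pos (x * w)).ne' (by rw [Real.tan_arctan, Real.tan_arctan])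
    exact DilationAtlas.notMem_nonHyperbolicDirections_of_cylinder hρ hψ hinj hθ₀ hc hcu

end Dilation

theorem mainTheorem8 {M : Type*} [TopologicalSpace M] [T2Space M] [CompactSpace M]
    [ConnectedSpace M] [ChartedSpace (EuclideanSpace ℝ (Fin 2)) M]
    (g n : ℕ) (p : Fin n → M) (D : Dilation.DilationAtlas M (Set.range p))
    (hD : Dilation.RepresentsMD g n p D)
    (hΘ : ¬ Tendsto (fun t : ℝ => (D.teichmullerFlow t).Theta) atTop (𝓝 0)) :
    ¬ Dilation.IsDensityPoint D.nonHyperbolicDirections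
      ((Real.pi / 2 : ℝ) : Dilation.Direction) := by
  have hπ := Real.pi_pos
  rw [ENNReal.tendsto_nhds_zero] at hΘ
  push Not at hΘ
  obtain ⟨δ, hδ, hfreq⟩ := hΘ
  have hfreq' : ∃ᶠ t in atTop, δ < (D.teichmullerFlow t).Theta := by
    simpa using hfreq
  have hδtop : δ ≠ ⊤ := by
    obtain ⟨t, ht⟩ := hfreq'.exists
    exact ht.ne_top
  have hδ0 : 0 < δ.toReal := ENNReal.toReal_pos hδ.ne' hδtop
  -- `h` depends on `δ` only, so the proportion below is the same for all `t`.
  set h := min (δ.toReal / 8) (Real.pi / 8) with hhdef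
  have hh : 0 < h := by positivity
  have hh1 : 8 * h ≤ δ.toReal := by linarith [min_le_left (δ.toReal / 8) (Real.pi / 8)]
  have hh2 : 8 * h ≤ Real.pi := by linarith [min_le_right (δ.toReal / 8) (Real.pi / 8)]
  set K := Real.tan (Real.pi / 2 - h) with hK
  have hK0 : 0 < K := Real.tan_pos_of_pos_of_lt_pi_div_two (by linarith) (by linarith)
  have hη : 0 < h / ((1 + K ^ 2) * (K + 1)) := by positivity
  refine Dilation.not_isDensityPoint_of_frequently hη ?_
  -- This turns arbitrarily large times into arbitrarily small radii.
  have htend : Tendsto (fun t : ℝ => Real.exp (-2 * t) * (K + 1)) atTop (𝓝[>] 0) := by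
    refine tendsto_nhdsWithin_iff.2 ⟨?_, Eventually.of_forall fun t => ?_⟩
    · have h1 : Tendsto (fun t : ℝ => -2 * t) atTop atBot :=
        tendsto_id.const_mul_atTop_of_neg (by norm_num)
      simpa using (Real.tendsto_exp_atBot.comp h1).mul_const (K + 1)
    · exact mul_pos (Real.exp_pos _) (by linarith)
  refine htend.frequently ((hfreq'.and_eventually (eventually_ge_atTop 0)).mono ?_)
  rintro t ⟨hlt, ht⟩
  simp only [Dilation.DilationAtlas.Theta, lt_iSup_iff] at hlt
  obtain ⟨α, β, ρ, hcyl, hlt⟩ := hlt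
  exact Dilation.exists_arc_of_containsCylinder ht hh hh2
    (hh1.trans ((ENNReal.lt_ofReal_iff_toReal_lt hδtop).1 hlt).le) hcyl hK
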